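/- All rings are commutative with $1$. For a ring $R$, an étale $R$-algebra of degree $n$ is an étale $R$-algebra $A$ that is a finitely generated projective $R$-module of constant rank $n$ (quadratic means $n=2$). We say that $A$ is generated by $m$ elements if there are $a_1,\dots,a_m\in A$ such that no proper $R$-subalgebra of $A$ contains all of them. **Proposition (Ojanguren).** Let $r\ge 1$, let $S=\mathbb{R}[z_1,\dots,z_r]/\bigl(\sum_{i=1}^r z_i^2-1\bigr)$, let the group $C_2$ of order two act on the $\mathbb{R}$-algebra $S$ by $z_i\mapsto -z_i$, and let $R=S^{C_2}$ be the fixed ring. 1. $R$ is a smooth $\mathbb{R}$-algebra of Krull dimension $r-1$. 2. $S$ is a quadratic étale $R$-algebra. It can be generated by $r$ elements over $R$, but not by fewer than $r$ elements. 3. For every $n\ge 2$, the $R$-algebra $S\times R^{n-2}$ is étale of degree $n$. It can be generated by $r=\dim R+1$ elements over $R$, but not by fewer than $r$ elements. Consequently the bound $\dim R+1$ of First and Reichstein on the number of generators of an étale algebra cannot be improved in any dimension $d\ge 0$ and any degree $n\ge 2$: if $m$ is a number such that, for every smooth $\mathbb{R}$-algebra $R'$ of Krull dimension $d$, every étale $R'$-algebra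 of degree $n$ can be generated by $m$ elements, then $m\ge d+1$. -/

import Mathlib

open MvPolynomial

noncomputable section

/-- The cyclic group of order two, written multiplicatively. -/
abbrev C₂ : Type := Multiplicative (ZMod 2)

/-- The ideal of `ℝ[z₁, …, z_r]` generated by `∑ zᵢ² - 1`. -/
def sphereIdeal (r : ℕ) : Ideal (MvPolynomial (Fin r) ℝ) :=
  Ideal.span {∑ i, X i ^ 2 - 1}

/-- The ring `S = ℝ[z₁, …, z_r] / (∑ zᵢ² - 1)`. -/
def SphereRing (r : ℕ) : Type := MvPolynomial (Fin r) ℝ ⧸ sphereIdeal r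

instance SphereRing.instCommRing (r : ℕ) : CommRing (SphereRing r) :=
  inferInstanceAs (CommRing (MvPolynomial (Fin r) ℝ ⧸ sphereIdeal r))

instance SphereRing.instAlgebra (r : ℕ) : Algebra ℝ (SphereRing r) :=
  inferInstanceAs (Algebra ℝ (MvPolynomial (Fin r) ℝ ⧸ sphereIdeal r))

/-- The quotient map from `ℝ[z₁, …, z_r]` to `S`. -/
def SphereRing.mk (r : ℕ) : MvPolynomial (Fin r) ℝ →ₐ[ℝ] SphereRing r :=
  Ideal.Quotient.mkₐ ℝ (sphereIdeal r)

theorem SphereRing.mk_surjective (r : ℕ) : Function.Surjective (SphereRing.mk r) :=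
  Ideal.Quotient.mkₐ_surjective ℝ (sphereIdeal r)

theorem SphereRing.mk_eq_zero_iff {r : ℕ} (p : MvPolynomial (Fin r) ℝ) :
    SphereRing.mk r p = 0 ↔ p ∈ sphereIdeal r :=
  Ideal.Quotient.eq_zero_iff_mem

/-- The class of the variable `zᵢ` in `S`. -/
def SphereRing.z {r : ℕ} (i : Fin r) : SphereRing r := SphereRing.mk r (X i)

theorem SphereRing.sum_z_sq (r : ℕ) : ∑ i : Fin r, SphereRing.z i ^ 2 = 1 := by
  have h : SphereRing.mk r (∑ i, X i ^ 2 - 1) = 0 :=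
    (SphereRing.mk_eq_zero_iff _).2 (Ideal.subset_span rfl)
  simpa [SphereRing.z, sub_eq_zero] using h

/-- The endomorphism of the `ℝ`-algebra `S` with `zᵢ ↦ -zᵢ`. -/
def SphereRing.negHom (r : ℕ) : SphereRing r →ₐ[ℝ] SphereRing r :=
  Ideal.Quotient.liftₐ (sphereIdeal r)
    (aeval fun i => -SphereRing.z i : MvPolynomial (Fin r) ℝ →ₐ[ℝ] SphereRing r) (by
    intro a ha
    have h : sphereIdeal r ≤
        RingHom.ker (aeval fun i => -SphereRing.z i : MvPolynomial (Fin r) ℝ →ₐ[ℝ] SphereRing r) := by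
      refine (Ideal.span_singleton_le_iff_mem _).2 (RingHom.mem_ker.2 ?_)
      simp [SphereRing.sum_z_sq]
    exact h ha)

theorem SphereRing.negHom_z {r : ℕ} (i : Fin r) :
    SphereRing.negHom r (SphereRing.z i) = -SphereRing.z i := by
  have h : SphereRing.negHom r (SphereRing.z i) =
      (aeval fun i => -SphereRing.z i : MvPolynomial (Fin r) ℝ →ₐ[ℝ] SphereRing r) (X i) := rfl
  rw [h, aeval_X]

theorem SphereRing.negHom_comp_negHom (r : ℕ) :
    (SphereRing.negHom r).comp (SphereRing.negHom r) = AlgHom.id ℝ (SphereRing r) := by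
  have h : ((SphereRing.negHom r).comp (SphereRing.negHom r)).comp (SphereRing.mk r) =
      (AlgHom.id ℝ (SphereRing r)).comp (SphereRing.mk r) := by
    apply MvPolynomial.algHom_ext
    intro i
    change SphereRing.negHom r (SphereRing.negHom r (SphereRing.z i)) = SphereRing.z i
    rw [SphereRing.negHom_z, map_neg, SphereRing.negHom_z, neg_neg]
  ext x
  obtain ⟨p, rfl⟩ := SphereRing.mk_surjective r x
  exact DFunLike.congr_fun h p

/-- The automorphism of the `ℝ`-algebra `S` with `zᵢ ↦ -zᵢ`. -/
def SphereRing.neg (r : ℕ) : SphereRing r ≃ₐ[ℝ] SphereRing r :=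
  AlgEquiv.ofAlgHom (SphereRing.negHom r) (SphereRing.negHom r)
    (SphereRing.negHom_comp_negHom r) (SphereRing.negHom_comp_negHom r)

theorem SphereRing.neg_mul_neg (r : ℕ) : SphereRing.neg r * SphereRing.neg r = 1 :=
  AlgEquiv.ext fun x => DFunLike.congr_fun (SphereRing.negHom_comp_negHom r) x

/-- The homomorphism from the group of order two to the automorphisms of `S` that sends the
generator to `zᵢ ↦ -zᵢ`. -/
def SphereRing.actionHom (r : ℕ) : C₂ →* (SphereRing r ≃ₐ[ℝ] SphereRing r) :=
  AddMonoidHom.toMultiplicativeLeft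
    (ZMod.lift 2 ⟨zmultiplesHom _ (Additive.ofMul (SphereRing.neg r)), by
      change (2 : ℤ) • Additive.ofMul (SphereRing.neg r) = 0
      rw [two_zsmul]
      exact congrArg Additive.ofMul (SphereRing.neg_mul_neg r)⟩)

/-- The action of the group of order two on `S` by `zᵢ ↦ -zᵢ`. -/
instance SphereRing.action (r : ℕ) : MulSemiringAction C₂ (SphereRing r) :=
  MulSemiringAction.compHom (SphereRing r) (SphereRing.actionHom r)

theorem SphereRing.generator_smul (r : ℕ) (x : SphereRing r) :
    (Multiplicative.ofAdd (1 : ZMod 2) : C₂) • x = SphereRing.neg r x := by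
  change SphereRing.actionHom r (Multiplicative.ofAdd (1 : ZMod 2)) x = _
  have h : SphereRing.actionHom r (Multiplicative.ofAdd (1 : ZMod 2)) = SphereRing.neg r := by
    have := ZMod.lift_coe 2 (⟨zmultiplesHom _ (Additive.ofMul (SphereRing.neg r)), by
      change (2 : ℤ) • Additive.ofMul (SphereRing.neg r) = 0
      rw [two_zsmul]
      exact congrArg Additive.ofMul (SphereRing.neg_mul_neg r)⟩ :
        { f : ℤ →+ Additive (SphereRing r ≃ₐ[ℝ] SphereRing r) // f (2 : ℕ) = 0 }) 1
    simp only [Int.cast_one, zmultiplesHom_apply, one_zsmul] at this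
    exact congrArg Additive.toMul this
  rw [h]

theorem SphereRing.generator_smul_z {r : ℕ} (i : Fin r) :
    (Multiplicative.ofAdd (1 : ZMod 2) : C₂) • SphereRing.z i = -SphereRing.z i := by
  rw [SphereRing.generator_smul]
  exact SphereRing.negHom_z i

instance SphereRing.smulCommClass (r : ℕ) : SMulCommClass C₂ ℝ (SphereRing r) where
  smul_comm g a x := map_smul (SphereRing.actionHom r g) a x

/-- The fixed ring `R = S^{C₂}`, an `ℝ`-subalgebra of `S`. -/
abbrev SphereRing.Fixed (r : ℕ) : Subalgebra ℝ (SphereRing r) :=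
  FixedPoints.subalgebra ℝ (SphereRing r) C₂

end

/-- `A` is an étale `R`-algebra of degree `n`: it is étale, and it is a finitely generated
projective `R`-module of constant rank `n`. -/
structure IsEtaleOfDegree (R A : Type*) [CommRing R] [CommRing A] [Algebra R A] (n : ℕ) :
    Prop where
  etale : Algebra.Etale R A
  finite : Module.Finite R A
  projective : Module.Projective R A
  rank_eq : ∀ p : PrimeSpectrum R, Module.rankAtStalk (R := R) A p = n

/-- The `R`-algebra `A` can be generated by `m` elements. -/
def IsGeneratedBy (R A : Type*) [CommRing R] [CommRing A] [Algebra R A] (m : ℕ) : Prop :=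
  ∃ a : Fin m → A, Algebra.adjoin R (Set.range a) = ⊤

-- Every element of `S` splits into an even and an odd part. Since ∑ zᵢ² = 1, an odd element is a
-- combination of the `z i` with even coefficients. Hence `S` is finite projective over `R`, with
-- `1, z i` as a basis wherever zᵢ² is invertible. Differentiating the invariants zᵢzⱼ shows that
-- `S` is unramified, hence étale. Geometrically `R` belongs to projective space minus the quadric ∑
-- zᵢ² = 0. Its standard charts are localized polynomial rings, which gives smoothness
-- (`smooth_fixed`). The dimension is that of `S`, which is integral over a polynomial ring.
--
-- For the lower bound, suppose that `m < r` elements generate `S`. Their odd parts have a common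
-- zero `u` on the sphere (`exists_evalAt_eq_zero`), so the generators, and then all of `S`, fail to
-- separate `u` from its antipode. The coordinates do separate them. For `S × R^(n-2)`, project onto
-- `S`.
--
-- The Borsuk–Ulam input is proved algebraically. Odd functions are represented by forms of one odd
-- degree `d`. After dehomogenizing, the system Xᵢ^d + s fᵢ has a quotient algebra of dimension d^n
-- for all but countably many `s`. This number is odd, whereas a finite real algebra without real
-- points has even dimension, so there is a real zero. Letting `s` grow and normalizing to the
-- sphere, compactness yields a zero of the forms themselves.

universe u

/-! ### Even and odd parts; `S` is finite, projective and étale over `R`. -/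

namespace SphereRing

variable {r : ℕ}

theorem mem_fixed_iff (x : SphereRing r) : x ∈ Fixed r ↔ neg r x = x := by
  constructor
  · intro h
    rw [← generator_smul]
    exact h _
  · intro h g
    obtain ⟨g, rfl⟩ := Multiplicative.ofAdd.surjective g
    fin_cases g
    · exact one_smul C₂ x
    · exact (generator_smul r x).trans h

theorem neg_coe (a : Fixed r) : neg r (a : SphereRing r) = a :=
  (mem_fixed_iff _).1 a.2

theorem neg_z (i : Fin r) : neg r (z i) = -z i := negHom_z i

theorem neg_neg (x : SphereRing r) : neg r (neg r x) = x :=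
  DFunLike.congr_fun (neg_mul_neg r) x

theorem adjoin_range_z (r : ℕ) : Algebra.adjoin ℝ (Set.range (z : Fin r → SphereRing r)) = ⊤ := by
  have h := congrArg (Subalgebra.map (mk r)) (MvPolynomial.adjoin_range_X (σ := Fin r) (R := ℝ))
  rw [AlgHom.map_adjoin, Algebra.map_top, (AlgHom.range_eq_top _).2 (mk_surjective r),
    ← Set.range_comp] at h
  exact h

theorem adjoin_fixed_range_z (r : ℕ) :
    Algebra.adjoin (Fixed r) (Set.range (z : Fin r → SphereRing r)) = ⊤ := by
  rw [eq_top_iff]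
  rintro x -
  have hx : x ∈ Algebra.adjoin ℝ (Set.range (z : Fin r → SphereRing r)) := by
    rw [adjoin_range_z]; trivial
  induction hx using Algebra.adjoin_induction with
  | mem x hx => exact Algebra.subset_adjoin hx
  | algebraMap a =>
    exact Subalgebra.algebraMap_mem _ (⟨algebraMap ℝ _ a, Subalgebra.algebraMap_mem _ a⟩ : Fixed r)
  | add x y _ _ hx hy => exact add_mem hx hy
  | mul x y _ _ hx hy => exact mul_mem hx hy

theorem isGeneratedBy (r : ℕ) : IsGeneratedBy (Fixed r) (SphereRing r) r :=
  ⟨z, adjoin_fixed_range_z r⟩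

/-- The projection `x ↦ (x + σ x) / 2` from `S` onto its fixed ring. -/
noncomputable def evenPart (r : ℕ) : SphereRing r →ₗ[Fixed r] Fixed r where
  toFun x := ⟨(1 / 2 : ℝ) • (x + neg r x), by
    rw [mem_fixed_iff, map_smul, map_add, neg_neg, add_comm]⟩
  map_add' x y := by
    ext
    simp only [map_add, Subalgebra.coe_add, ← smul_add]
    congr 1
    ring
  map_smul' a x := by
    ext
    change (1 / 2 : ℝ) • ((a : SphereRing r) * x + neg r ((a : SphereRing r) * x)) =
      (a : SphereRing r) * (1 / 2 : ℝ) • (x + neg r x)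
    rw [map_mul, neg_coe, ← mul_add, Algebra.mul_smul_comm]

theorem coe_evenPart (x : SphereRing r) :
    (evenPart r x : SphereRing r) = (1 / 2 : ℝ) • (x + neg r x) := rfl

theorem add_neg (x : SphereRing r) : x + neg r x = 2 * evenPart r x := by
  rw [coe_evenPart, two_mul, ← two_smul ℝ, smul_smul]
  norm_num

theorem evenPart_coe (a : Fixed r) : evenPart r a = a := by
  ext
  rw [coe_evenPart, neg_coe, ← two_smul ℝ, smul_smul]
  norm_num

theorem coe_evenPart_z_mul (i : Fin r) (x : SphereRing r) :
    (evenPart r (z i * x) : SphereRing r) = z i * (x - evenPart r x) := by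
  have h : x = (1 / 2 : ℝ) • (x + x) := by rw [← two_smul ℝ, smul_smul]; norm_num
  rw [coe_evenPart, coe_evenPart, map_mul, neg_z]
  nth_rw 3 [h]
  rw [← smul_sub, Algebra.mul_smul_comm]
  congr 1
  ring

/-- Multiplying the odd part of `x` by `z i` makes it even, and multiplying by `z i` again and
summing recovers it, as ∑ zᵢ² = 1. This is the dual basis that makes `S` finite projective. -/
theorem evenPart_add_sum (x : SphereRing r) :
    (evenPart r x : SphereRing r) + ∑ i, (evenPart r (z i * x) : SphereRing r) * z i = x := by
  have h : ∀ i : Fin r, (evenPart r (z i * x) : SphereRing r) * z i =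
      z i ^ 2 * (x - evenPart r x) := fun i ↦ by rw [coe_evenPart_z_mul]; ring
  simp_rw [h, ← Finset.sum_mul, sum_z_sq]
  ring

/-- The coordinates of an element of `S` with respect to `1, z₁, …, z_r`. -/
noncomputable def toCoord (r : ℕ) : SphereRing r →ₗ[Fixed r] Fixed r × (Fin r → Fixed r) :=
  (evenPart r).prod (LinearMap.pi fun i ↦ evenPart r ∘ₗ LinearMap.mulLeft (Fixed r) (z i))

/-- The linear map with `(a, b) ↦ a + ∑ bᵢ zᵢ`. -/
noncomputable def ofCoord (r : ℕ) : Fixed r × (Fin r → Fixed r) →ₗ[Fixed r] SphereRing r :=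
  (Algebra.linearMap (Fixed r) (SphereRing r)).coprod (Fintype.linearCombination (Fixed r) z)

theorem ofCoord_comp_toCoord (r : ℕ) : ofCoord r ∘ₗ toCoord r = LinearMap.id := by
  ext x
  conv_rhs => rw [LinearMap.id_apply, ← evenPart_add_sum x]
  rfl

instance : Module.Finite (Fixed r) (SphereRing r) :=
  .of_surjective (ofCoord r) fun x ↦ ⟨toCoord r x, DFunLike.congr_fun (ofCoord_comp_toCoord r) x⟩

instance : Module.Projective (Fixed r) (SphereRing r) :=
  .of_split (toCoord r) (ofCoord r) (ofCoord_comp_toCoord r)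

instance : Algebra.FiniteType ℝ (SphereRing r) :=
  .of_surjective (mk r) (mk_surjective r)

instance : Algebra.FiniteType ℝ (Fixed r) :=
  ⟨fg_of_fg_of_fg ℝ (Fixed r) (SphereRing r) Algebra.FiniteType.out Module.Finite.fg_top
    Subtype.val_injective⟩

instance : IsNoetherianRing (Fixed r) := Algebra.FiniteType.isNoetherianRing ℝ _

theorem z_mul_z_mem (i j : Fin r) : z i * z j ∈ Fixed r := by
  rw [mem_fixed_iff, map_mul, neg_z, neg_z]
  ring

/-- The element `zᵢ zⱼ` of the fixed ring. -/
noncomputable def zz (i j : Fin r) : Fixed r := ⟨z i * z j, z_mul_z_mem i j⟩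

theorem sum_zz_self (r : ℕ) : ∑ i : Fin r, zz i i = 1 := by
  ext
  rw [Subalgebra.coe_one, ← sum_z_sq r, AddSubmonoidClass.coe_finsetSum]
  exact Finset.sum_congr rfl fun i _ ↦ (sq _).symm

/-- As zᵢzⱼ is a scalar, zᵢ dzⱼ = -zⱼ dzᵢ, and in particular zᵢ dzᵢ = 0 because 2 is invertible.
Then dzⱼ = ∑ zᵢ² dzⱼ = -∑ zⱼ zᵢ dzᵢ = 0. -/
instance : Algebra.FormallyUnramified (Fixed r) (SphereRing r) := by
  constructor
  set D := KaehlerDifferential.D (Fixed r) (SphereRing r)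
  have hD : ∀ i j : Fin r, z i • D (z j) = - z j • D (z i) := by
    intro i j
    have h : D (algebraMap (Fixed r) (SphereRing r) (zz i j)) = 0 := D.map_algebraMap _
    change D (z i * z j) = 0 at h
    rw [D.leibniz] at h
    rw [neg_smul]
    exact eq_neg_of_add_eq_zero_left h
  have hii : ∀ i : Fin r, z i • D (z i) = 0 := by
    intro i
    have h := hD i i
    rw [neg_smul, eq_neg_iff_add_eq_zero, ← two_smul ℝ, smul_eq_zero_iff_right two_ne_zero] at h
    exact h
  have hz : ∀ j : Fin r, D (z j) = 0 := by
    intro j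
    rw [← one_smul (SphereRing r) (D (z j)), ← sum_z_sq r, Finset.sum_smul]
    refine Finset.sum_eq_zero fun i _ ↦ ?_
    rw [sq, mul_smul, hD, neg_smul, smul_neg, smul_comm, hii, smul_zero, neg_zero]
  have h0 : D = 0 := by
    refine Derivation.ext_of_adjoin_eq_top _ (adjoin_fixed_range_z r) ?_
    rintro _ ⟨i, rfl⟩
    exact hz i
  refine subsingleton_of_forall_eq 0 fun x ↦ ?_
  have hx : x ∈ Submodule.span (SphereRing r) (Set.range D) := by
    rw [KaehlerDifferential.span_range_derivation]; trivial
  rw [h0] at hx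
  refine (Submodule.span_le (p := ⊥)).2 ?_ hx
  rintro _ ⟨y, rfl⟩
  rfl

instance : Algebra.FinitePresentation (Fixed r) (SphereRing r) :=
  (Algebra.FinitePresentation.of_finiteType).1 inferInstance

instance : Algebra.Etale (Fixed r) (SphereRing r) := .of_formallyUnramified_of_flat

/-- The linear map with `(a, b) ↦ a + b zᵢ`. -/
noncomputable def ofPair (i : Fin r) : Fixed r × Fixed r →ₗ[Fixed r] SphereRing r :=
  (Algebra.linearMap (Fixed r) (SphereRing r)).coprod (LinearMap.toSpanSingleton _ _ (z i))

/-- A map in the opposite direction to `ofPair` that inverts it up to multiplication by `zᵢ²`. -/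
noncomputable def toPair (i : Fin r) : SphereRing r →ₗ[Fixed r] Fixed r × Fixed r :=
  (zz i i • evenPart r).prod (evenPart r ∘ₗ LinearMap.mulLeft (Fixed r) (z i))

theorem evenPart_z (i : Fin r) : evenPart r (z i) = 0 := by
  ext
  rw [coe_evenPart, neg_z, add_neg_cancel, smul_zero]
  rfl

/-- With `ofPair_comp_toPair`, this makes `1, z i` a basis of `S` once zᵢ² is inverted, so the rank
is 2 there. These loci cover the spectrum by `exists_zz_notMem`. -/
theorem toPair_comp_ofPair (i : Fin r) : toPair i ∘ₗ ofPair i = zz i i • LinearMap.id := by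
  have h : ∀ a b : Fixed r, evenPart r (a + b * z i : SphereRing r) = a := fun a b ↦ by
    change evenPart r ((a : SphereRing r) + b • z i) = a
    rw [map_add, map_smul, evenPart_z, smul_zero, add_zero, evenPart_coe]
  refine LinearMap.ext fun ⟨a, b⟩ ↦ Prod.ext ?_ ?_
  · change zz i i • evenPart r (a + b * z i) = zz i i • a
    rw [h]
  · ext
    change (evenPart r (z i * (a + b * z i)) : SphereRing r) = z i * z i * b
    rw [coe_evenPart_z_mul, h]
    ring

theorem ofPair_comp_toPair (i : Fin r) : ofPair i ∘ₗ toPair i = zz i i • LinearMap.id := by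
  ext x
  change z i * z i * (evenPart r x : SphereRing r) + evenPart r (z i * x) * z i = z i * z i * x
  rw [coe_evenPart_z_mul]
  ring

theorem exists_zz_notMem (p : PrimeSpectrum (Fixed r)) : ∃ i, zz i i ∉ p.asIdeal := by
  by_contra! h
  refine p.2.ne_top ((Ideal.eq_top_iff_one _).2 ?_)
  rw [← sum_zz_self]
  exact Ideal.sum_mem _ fun i _ ↦ h i

end SphereRing

/-! ### Étale products and local ranks. -/

theorem Algebra.Etale.prod_bool {R : Type*} [CommRing R] (F : Bool → Type u)
    [∀ b, CommRing (F b)] [∀ b, Algebra R (F b)] [∀ b, Algebra.Etale R (F b)] :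
    Algebra.Etale R (F false × F true) :=
  .of_equiv (A := ∀ b, F b) <|
    .ofBijective ((Pi.evalAlgHom R F false).prod (Pi.evalAlgHom R F true))
      ⟨fun _ _ h ↦ funext (Bool.rec (congrArg Prod.fst h) (congrArg Prod.snd h)),
        fun x ↦ ⟨Bool.rec x.1 x.2, rfl⟩⟩

/-- The product of two étale algebras is étale. -/
theorem Algebra.Etale.prod {R : Type*} {A B : Type u} [CommRing R] [iA : CommRing A]
    [iB : CommRing B] [jA : Algebra R A] [jB : Algebra R B] [hA : Algebra.Etale R A]
    [hB : Algebra.Etale R B] : Algebra.Etale R (A × B) :=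
  @Algebra.Etale.prod_bool R _ (Bool.rec A B)
    (Bool.rec (motive := fun b ↦ CommRing (Bool.rec A B b : Type u)) iA iB)
    (fun b ↦ by cases b; exacts [jA, jB]) (fun b ↦ by cases b; exacts [hA, hB])

open TensorProduct in
/-- Two linear maps whose composites are both multiplication by an element outside a prime ideal
have domain and codomain of the same rank at that prime. -/
theorem Module.rankAtStalk_eq_of_comp_eq_smul {R M N : Type*} [CommRing R] [AddCommGroup M]
    [Module R M] [AddCommGroup N] [Module R N] (f : M →ₗ[R] N) (g : N →ₗ[R] M) (a : R)
    (hgf : g ∘ₗ f = a • LinearMap.id) (hfg : f ∘ₗ g = a • LinearMap.id) (p : PrimeSpectrum R)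
    (ha : a ∉ p.asIdeal) : rankAtStalk (R := R) M p = rankAtStalk (R := R) N p := by
  let Rp := Localization.AtPrime p.asIdeal
  obtain ⟨u, hu⟩ : IsUnit (algebraMap R Rp a) :=
    IsLocalization.map_units Rp (⟨a, ha⟩ : p.asIdeal.primeCompl)
  have hgf' : g.baseChange Rp ∘ₗ f.baseChange Rp = (u : Rp) • LinearMap.id := by
    rw [← LinearMap.baseChange_comp, hgf, hu, LinearMap.baseChange_smul]
    ext x
    simp
  have hfg' : f.baseChange Rp ∘ₗ g.baseChange Rp = (u : Rp) • LinearMap.id := by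
    rw [← LinearMap.baseChange_comp, hfg, hu, LinearMap.baseChange_smul]
    ext x
    simp
  rw [rankAtStalk_eq_finrank_tensorProduct, rankAtStalk_eq_finrank_tensorProduct]
  refine LinearEquiv.finrank_eq (LinearEquiv.ofLinearMap (f.baseChange Rp)
    (((u⁻¹ : Rpˣ) : Rp) • g.baseChange Rp) ?_ ?_)
  · rw [LinearMap.comp_smul, hfg', smul_smul, Units.inv_mul, one_smul]
  · rw [LinearMap.smul_comp, hgf', smul_smul, Units.inv_mul, one_smul]

namespace SphereRing

variable {r : ℕ}

theorem rankAtStalk_eq_two (p : PrimeSpectrum (Fixed r)) :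
    Module.rankAtStalk (R := Fixed r) (SphereRing r) p = 2 := by
  obtain ⟨i, hi⟩ := exists_zz_notMem p
  have := p.nontrivial
  rw [← Module.rankAtStalk_eq_of_comp_eq_smul (ofPair i) (toPair i) _ (toPair_comp_ofPair i)
    (ofPair_comp_toPair i) p hi, Module.rankAtStalk_prod]
  simp

theorem isEtaleOfDegree_two (r : ℕ) : IsEtaleOfDegree (Fixed r) (SphereRing r) 2 where
  etale := inferInstance
  finite := inferInstance
  projective := inferInstance
  rank_eq := rankAtStalk_eq_two

theorem isEtaleOfDegree_prod (r n : ℕ) (hn : 2 ≤ n) :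
    IsEtaleOfDegree (Fixed r) (SphereRing r × (Fin (n - 2) → Fixed r)) n where
  etale := .prod
  finite := inferInstance
  projective := inferInstance
  rank_eq p := by
    have := p.nontrivial
    rw [Module.rankAtStalk_prod, Pi.add_apply, rankAtStalk_eq_two]
    simp
    omega

end SphereRing

/-! ### Real points of the sphere. -/

namespace SphereRing

variable {r : ℕ}

/-- Evaluation of the elements of `S` at a point of the unit sphere. -/
noncomputable def evalAt (x : Fin r → ℝ) (hx : ∑ i, x i ^ 2 = 1) : SphereRing r →ₐ[ℝ] ℝ :=
  Ideal.Quotient.liftₐ (sphereIdeal r) (aeval x) fun a ha ↦ by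
    have h : sphereIdeal r ≤ RingHom.ker (aeval x : MvPolynomial (Fin r) ℝ →ₐ[ℝ] ℝ) := by
      refine (Ideal.span_singleton_le_iff_mem _).2 (RingHom.mem_ker.2 ?_)
      simp [hx]
    exact h ha

theorem evalAt_mk (x : Fin r → ℝ) (hx : ∑ i, x i ^ 2 = 1) (p : MvPolynomial (Fin r) ℝ) :
    evalAt x hx (mk r p) = eval x p := by
  rw [← aeval_eq_eval]
  rfl

theorem evalAt_z (x : Fin r → ℝ) (hx : ∑ i, x i ^ 2 = 1) (i : Fin r) :
    evalAt x hx (z i) = x i := by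
  rw [z, evalAt_mk, eval_X]

end SphereRing

/-! ### Krull dimension. -/

section Dimension

/-- An injective integral ring extension preserves the Krull dimension. -/
theorem ringKrullDim_eq_of_isIntegral {A B : Type*} [CommRing A] [CommRing B] [Algebra A B]
    [Algebra.IsIntegral A B] (h : Function.Injective (algebraMap A B)) :
    ringKrullDim A = ringKrullDim B := by
  apply le_antisymm
  -- Going up lifts chains of primes from `A` to `B`; tracking the last prime lets the induction
  -- extend the lift.
  · have key : ∀ p : LTSeries (PrimeSpectrum A), ∃ q : LTSeries (PrimeSpectrum B),
        q.length = p.length ∧ PrimeSpectrum.comap (algebraMap A B) q.last = p.last := by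
      intro p
      induction p using RelSeries.inductionOn' with
      | singleton x =>
        obtain ⟨Q, -, hQ, hQx⟩ := Ideal.exists_ideal_over_prime_of_isIntegral x.asIdeal
          (⊥ : Ideal B) (by
            rw [← RingHom.ker_eq_comap_bot, (RingHom.injective_iff_ker_eq_bot _).1 h]
            exact bot_le)
        exact ⟨RelSeries.singleton _ ⟨Q, hQ⟩, rfl, PrimeSpectrum.ext hQx⟩
      | snoc p x hx ih =>
        obtain ⟨q, hq, hqp⟩ := ih
        have hlt : p.last < x := hx
        obtain ⟨Q, hle, hQ, hQx⟩ := Ideal.exists_ideal_over_prime_of_isIntegral x.asIdeal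
          q.last.asIdeal (by
            have := hlt.le
            rw [← hqp] at this
            exact this)
        have hlt' : q.last < ⟨Q, hQ⟩ := by
          refine lt_of_le_of_ne hle fun he ↦ hlt.ne ?_
          rw [← hqp, he]
          exact PrimeSpectrum.ext hQx
        refine ⟨q.snoc ⟨Q, hQ⟩ hlt', by simp [hq], ?_⟩
        rw [RelSeries.last_snoc, RelSeries.last_snoc]
        exact PrimeSpectrum.ext hQx
    refine iSup_le fun p ↦ ?_
    obtain ⟨q, hq, -⟩ := key p
    rw [← hq]
    exact Order.LTSeries.length_le_krullDim q
  -- Incomparability: strict inclusions of primes stay strict after contraction.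
  · refine Order.krullDim_le_of_strictMono (PrimeSpectrum.comap (algebraMap A B)) ?_
    intro I J hIJ
    exact Ideal.IsIntegral.comap_lt_comap hIJ

end Dimension

namespace SphereRing

variable {r : ℕ}

/-- The homomorphism from a polynomial ring in `n` variables to the coordinate ring of the
`n`-sphere that omits the first coordinate. -/
noncomputable def tailHom (n : ℕ) : MvPolynomial (Fin n) ℝ →ₐ[ℝ] SphereRing (n + 1) :=
  aeval fun j ↦ z j.succ

theorem tailHom_injective (n : ℕ) : Function.Injective (tailHom n) := by
  rw [injective_iff_map_eq_zero]
  intro p hp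
  -- The box is small enough that ∑ tⱼ² ≤ 1, so each of its points is the tail of a point of the
  -- sphere, where `p` must vanish.
  refine MvPolynomial.funext_set (fun _ ↦ Set.Ioo (0 : ℝ) (1 / (n + 1)))
    (fun _ ↦ Set.Ioo_infinite (by positivity)) fun t ht ↦ ?_
  rw [map_zero]
  have hsum : ∑ j, t j ^ 2 ≤ 1 := by
    have h1 : ∀ j, t j ^ 2 ≤ 1 / (n + 1) := fun j ↦ by
      obtain ⟨h0, h1⟩ := ht j trivial
      have h2 : (1 : ℝ) / (n + 1) ≤ 1 := by
        rw [div_le_one (by positivity)]; linarith [(Nat.cast_nonneg n : (0 : ℝ) ≤ n)]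
      nlinarith
    refine (Finset.sum_le_sum fun j _ ↦ h1 j).trans ?_
    rw [Finset.sum_const, Finset.card_univ, Fintype.card_fin, nsmul_eq_mul, mul_one_div,
      div_le_one (by positivity)]
    linarith
  have hx : ∑ i, (Fin.cons (√(1 - ∑ j, t j ^ 2)) t : Fin (n + 1) → ℝ) i ^ 2 = 1 := by
    rw [Fin.sum_univ_succ]
    simp only [Fin.cons_zero, Fin.cons_succ]
    rw [Real.sq_sqrt (by linarith)]
    ring
  have h : (evalAt _ hx).comp (tailHom n) = aeval t := by
    apply MvPolynomial.algHom_ext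
    intro j
    rw [AlgHom.comp_apply, tailHom, aeval_X, aeval_X, evalAt_z, Fin.cons_succ]
  have := DFunLike.congr_fun h p
  rw [AlgHom.comp_apply, hp, map_zero, aeval_eq_eval] at this
  exact this.symm

/-- The only generator outside the image is `z 0`, and its square is 1 minus the squares of the
others. -/
theorem tailHom_isIntegral (n : ℕ) : (tailHom n).toRingHom.IsIntegral := by
  algebraize [(tailHom n).toRingHom]
  have : IsScalarTower ℝ (MvPolynomial (Fin n) ℝ) (SphereRing (n + 1)) :=
    .of_algebraMap_eq fun c ↦ ((tailHom n).commutes c).symm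
  have hsucc : ∀ j : Fin n, algebraMap (MvPolynomial (Fin n) ℝ) (SphereRing (n + 1)) (X j) =
      z j.succ := fun j ↦ aeval_X _ j
  have hz : ∀ i : Fin (n + 1), IsIntegral (MvPolynomial (Fin n) ℝ) (z i : SphereRing (n + 1)) := by
    intro i
    refine Fin.cases ?_ (fun j ↦ ?_) i
    · refine IsIntegral.of_pow two_pos ?_
      have h := sum_z_sq (n + 1)
      rw [Fin.sum_univ_succ] at h
      rw [eq_sub_of_add_eq h]
      refine isIntegral_one.sub (IsIntegral.sum _ fun j _ ↦ IsIntegral.pow ?_ 2)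
      rw [← hsucc]
      exact isIntegral_algebraMap
    · rw [← hsucc]
      exact isIntegral_algebraMap
  intro x
  have hx : x ∈ Algebra.adjoin ℝ (Set.range (z : Fin (n + 1) → SphereRing (n + 1))) := by
    rw [adjoin_range_z]; trivial
  have hle : Algebra.adjoin ℝ (Set.range (z : Fin (n + 1) → SphereRing (n + 1))) ≤
      (integralClosure (MvPolynomial (Fin n) ℝ) (SphereRing (n + 1))).restrictScalars ℝ := by
    refine Algebra.adjoin_le ?_
    rintro _ ⟨i, rfl⟩
    exact hz i
  exact hle hx

theorem ringKrullDim_succ (n : ℕ) : ringKrullDim (SphereRing (n + 1)) = n := by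
  algebraize [(tailHom n).toRingHom]
  have : Algebra.IsIntegral (MvPolynomial (Fin n) ℝ) (SphereRing (n + 1)) :=
    ⟨tailHom_isIntegral n⟩
  rw [← ringKrullDim_eq_of_isIntegral (A := MvPolynomial (Fin n) ℝ) (tailHom_injective n),
    ringKrullDim_of_isNoetherianRing, ringKrullDim_eq_zero_of_field]
  simp

theorem ringKrullDim_fixed (hr : 1 ≤ r) : ringKrullDim (Fixed r) = ((r - 1 : ℕ) : WithBot ℕ∞) := by
  obtain ⟨n, rfl⟩ := Nat.exists_eq_add_of_le' hr
  rw [ringKrullDim_eq_of_isIntegral (A := Fixed (n + 1)) (B := SphereRing (n + 1))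
    Subtype.val_injective, ringKrullDim_succ]
  rfl

/-! ### Generators of `S × R^k`. -/

section Product

variable {k : ℕ}

/-- The components 1, 4, 9, … of the given element are distinct reals, so a Lagrange polynomial in
that element attains any prescribed real components. In particular `B` contains the idempotents of
the factors. -/
theorem algebraMap_mem_of_sum_sq_mem (B : Subalgebra (Fixed r) (SphereRing r × (Fin k → Fixed r)))
    (hB : ((1 : SphereRing r), fun j : Fin k ↦ algebraMap ℝ (Fixed r) (((j : ℕ) + 2) ^ 2)) ∈ B) (c : ℝ) (d : Fin k → ℝ) :
    (algebraMap ℝ (SphereRing r) c, fun j ↦ algebraMap ℝ (Fixed r) (d j)) ∈ B := by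
  let v : Option (Fin k) → ℝ := fun o ↦ o.elim 1 fun j ↦ ((j : ℕ) + 2) ^ 2
  let w : Option (Fin k) → ℝ := fun o ↦ o.elim c d
  have hv : Function.Injective v := by
    have h1 : ∀ j : Fin k, (1 : ℝ) ≠ ((j : ℕ) + 2) ^ 2 := fun j ↦ by
      have : (0 : ℝ) ≤ (j : ℕ) := Nat.cast_nonneg _
      nlinarith
    rintro (_ | i) (_ | j) h
    · rfl
    · exact absurd h (h1 j)
    · exact absurd h.symm (h1 i)
    · have h' : ((i : ℕ) + 2 : ℝ) = (j : ℕ) + 2 :=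
        (pow_left_inj₀ (by positivity) (by positivity) two_ne_zero).1 h
      rw [add_left_inj, Nat.cast_inj] at h'
      rw [Fin.ext h']
  let p := Lagrange.interpolate Finset.univ v w
  have hp : ∀ o, p.eval (v o) = w o := fun o ↦
    Lagrange.eval_interpolate_at_node _ hv.injOn (Finset.mem_univ o)
  have hmem := Algebra.adjoin_le (S := B.restrictScalars ℝ) (Set.singleton_subset_iff.2 hB)
    (Polynomial.aeval_mem_adjoin_singleton ℝ _ (p := p))
  rw [Polynomial.aeval_prod_apply, Polynomial.aeval_pi_apply] at hmem
  have h1 : algebraMap ℝ (SphereRing r) c = Polynomial.aeval 1 p := by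
    rw [← map_one (algebraMap ℝ (SphereRing r)), Polynomial.aeval_algebraMap_apply]
    exact congrArg _ (hp none).symm
  have h2 : ∀ j : Fin k, algebraMap ℝ (Fixed r) (d j) =
      Polynomial.aeval (algebraMap ℝ (Fixed r) (((j : ℕ) + 2) ^ 2)) p := fun j ↦ by
    rw [Polynomial.aeval_algebraMap_apply]
    exact congrArg _ (hp (some j)).symm
  rw [h1, _root_.funext h2]
  exact hmem

theorem isGeneratedBy_prod (hr : 1 ≤ r) :
    IsGeneratedBy (Fixed r) (SphereRing r × (Fin k → Fixed r)) r := by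
  let i₀ : Fin r := ⟨0, hr⟩
  let a : Fin r → SphereRing r × (Fin k → Fixed r) := fun i ↦
    -- The sum of the squares of these elements has first component 1. The shift by 2 keeps the
    -- other components distinct from it, so no additional generator is needed to separate the
    -- factors.
    (z i, fun j ↦ algebraMap ℝ (Fixed r) (if i = i₀ then (j : ℕ) + 2 else 0))
  refine ⟨a, ?_⟩
  set B := Algebra.adjoin (Fixed r) (Set.range a)
  have ha : ∀ i, a i ∈ B := fun i ↦ Algebra.subset_adjoin ⟨i, rfl⟩
  have hB := algebraMap_mem_of_sum_sq_mem B (by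
    have h : ∑ i, a i ^ 2 ∈ B := sum_mem fun i _ ↦ pow_mem (ha i) 2
    convert h using 1
    refine Prod.ext ?_ (_root_.funext fun j ↦ ?_)
    · rw [Prod.fst_sum]
      exact (sum_z_sq r).symm
    · rw [Prod.snd_sum, Finset.sum_apply, Finset.sum_eq_single i₀]
      · simp [a]
      · intro i _ hi
        simp [a, hi]
      · simp)
  have h1 : ((1 : SphereRing r), (0 : Fin k → Fixed r)) ∈ B := by
    convert hB 1 0 using 2
    · simp
    · ext; simp
  have hS : ∀ x : SphereRing r, (x, (0 : Fin k → Fixed r)) ∈ B := by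
    intro x
    have hx : x ∈ Algebra.adjoin (Fixed r) (Set.range (z : Fin r → SphereRing r)) := by
      rw [adjoin_fixed_range_z]; trivial
    induction hx using Algebra.adjoin_induction with
    | mem x hx =>
      obtain ⟨i, rfl⟩ := hx
      convert mul_mem h1 (ha i) using 1
      simp [a]
    | algebraMap c =>
      convert B.smul_mem h1 c using 1
      rw [Prod.smul_mk, smul_zero, Algebra.algebraMap_eq_smul_one]
    | add x y _ _ hx hy =>
      convert add_mem hx hy using 1
      simp
    | mul x y _ _ hx hy =>
      convert mul_mem hx hy using 1
      simp
  have hR : ∀ f : Fin k → Fixed r, ((0 : SphereRing r), f) ∈ B := by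
    intro f
    have h : ∑ j, f j • ((0 : SphereRing r), (Pi.single j 1 : Fin k → Fixed r)) ∈ B := by
      refine sum_mem fun j _ ↦ B.smul_mem ?_ _
      convert hB 0 (Pi.single j 1) using 2
      · simp
      · ext i
        by_cases hij : i = j
        · subst hij; simp
        · simp [hij]
    convert h using 1
    refine Prod.ext ?_ (_root_.funext fun j ↦ ?_)
    · simp [Prod.fst_sum]
    · simp [Prod.snd_sum, Finset.sum_apply, Pi.single_apply]
  rw [eq_top_iff]
  rintro ⟨x, f⟩ -
  convert add_mem (hS x) (hR f) using 1
  simp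

end Product

end SphereRing

theorem IsGeneratedBy.of_surjective {R A B : Type*} [CommRing R] [CommRing A] [CommRing B]
    [Algebra R A] [Algebra R B] {m : ℕ} (h : IsGeneratedBy R A m) (f : A →ₐ[R] B)
    (hf : Function.Surjective f) : IsGeneratedBy R B m := by
  obtain ⟨a, ha⟩ := h
  refine ⟨f ∘ a, ?_⟩
  rw [Set.range_comp, ← AlgHom.map_adjoin, ha, Algebra.map_top, (AlgHom.range_eq_top f).2 hf]

/-! ### Smoothness of `R` through the charts where zᵢ² is invertible. -/

namespace SphereRing

variable {r : ℕ}

theorem algebraMap_half_mul_two (r : ℕ) :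
    algebraMap ℝ (SphereRing r) (1 / 2) * 2 = 1 := by
  rw [← map_ofNat (algebraMap ℝ (SphereRing r)) 2, ← map_mul]
  norm_num

theorem evenPart_mul (x y : SphereRing r) : evenPart r (x * y) =
    evenPart r x * evenPart r y +
      ∑ i, ∑ j, zz i j * (evenPart r (z i * x) * evenPart r (z j * y)) := by
  have h1 : (evenPart r (x * y) : SphereRing r) = evenPart r x * evenPart r y +
      (x - evenPart r x) * (y - evenPart r y) := by
    have h2 := algebraMap_half_mul_two r
    simp only [coe_evenPart, Algebra.smul_def, map_mul]
    linear_combination (x * y - algebraMap ℝ (SphereRing r) (1 / 2) *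
      ((x + neg r x) * (y + neg r y))) * h2
  ext
  rw [h1]
  simp only [Subalgebra.coe_add, Subalgebra.coe_mul, AddSubmonoidClass.coe_finsetSum,
    coe_evenPart_z_mul]
  have h3 : ∀ i j : Fin r, (zz i j : SphereRing r) *
      (z i * (x - evenPart r x) * (z j * (y - evenPart r y))) =
      z i ^ 2 * z j ^ 2 * ((x - evenPart r x) * (y - evenPart r y)) := fun i j ↦ by
    change z i * z j * _ = _
    ring
  simp_rw [h3, ← Finset.sum_mul, ← Finset.mul_sum, ← Finset.sum_mul, sum_z_sq, one_mul]

theorem evenPart_z_mul_mul (i : Fin r) (x y : SphereRing r) : evenPart r (z i * (x * y)) =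
    evenPart r (z i * x) * evenPart r y + evenPart r x * evenPart r (z i * y) := by
  have h2 := algebraMap_half_mul_two r
  ext
  simp only [Subalgebra.coe_add, Subalgebra.coe_mul, coe_evenPart, Algebra.smul_def, map_mul,
    neg_z]
  linear_combination (-algebraMap ℝ (SphereRing r) (1 / 2) * z i *
    (x * y - neg r x * neg r y)) * h2

/-- The elements of `S` whose coordinates in `toCoord` all lie in `C` are closed under products, by
`evenPart_mul` and `evenPart_z_mul_mul`, so they exhaust `S`. An invariant element is its own even
part. -/
theorem adjoin_range_zz (r : ℕ) :
    Algebra.adjoin ℝ (Set.range fun p : Fin r × Fin r ↦ zz p.1 p.2) = ⊤ := by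
  set C := Algebra.adjoin ℝ (Set.range fun p : Fin r × Fin r ↦ zz p.1 p.2)
  have hzz : ∀ i j, zz i j ∈ C := fun i j ↦ Algebra.subset_adjoin ⟨(i, j), rfl⟩
  have key : ∀ x : SphereRing r, evenPart r x ∈ C ∧ ∀ i, evenPart r (z i * x) ∈ C := by
    intro x
    have hx : x ∈ Algebra.adjoin ℝ (Set.range (z : Fin r → SphereRing r)) := by
      rw [adjoin_range_z]; trivial
    induction hx using Algebra.adjoin_induction with
    | mem x hx =>
      obtain ⟨j, rfl⟩ := hx
      rw [evenPart_z]
      exact ⟨zero_mem _, fun i ↦ by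
        have h : evenPart r (z i * z j) = zz i j := evenPart_coe (zz i j)
        rw [h]
        exact hzz i j⟩
    | algebraMap c =>
      have h : evenPart r (algebraMap ℝ (SphereRing r) c) = algebraMap ℝ (Fixed r) c :=
        evenPart_coe (algebraMap ℝ (Fixed r) c)
      refine ⟨h ▸ algebraMap_mem C c, fun i ↦ ?_⟩
      have h' : evenPart r (z i * algebraMap ℝ (SphereRing r) c) =
          algebraMap ℝ (Fixed r) c • evenPart r (z i) := by
        rw [← map_smul, mul_comm, Algebra.smul_def]
        rfl
      rw [h', evenPart_z, smul_zero]
      exact zero_mem _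
    | add x y _ _ hx hy =>
      refine ⟨by rw [map_add]; exact add_mem hx.1 hy.1, fun i ↦ ?_⟩
      rw [mul_add, map_add]
      exact add_mem (hx.2 i) (hy.2 i)
    | mul x y _ _ hx hy =>
      refine ⟨?_, fun i ↦ ?_⟩
      · rw [evenPart_mul]
        exact add_mem (mul_mem hx.1 hy.1) (sum_mem fun i _ ↦ sum_mem fun j _ ↦
          mul_mem (hzz i j) (mul_mem (hx.2 i) (hy.2 j)))
      · rw [evenPart_z_mul_mul]
        exact add_mem (mul_mem (hx.2 i) hy.1) (mul_mem hx.1 (hy.2 i))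
  rw [eq_top_iff]
  rintro a -
  rw [← evenPart_coe a]
  exact (key a).1

section Chart

variable (i : Fin r)

/-- The affine chart of the fixed ring where `zᵢ²` is invertible. -/
abbrev Chart : Type := Localization.Away (zz i i)

/-- The coordinate `zₖ / zᵢ` on the chart where `zᵢ²` is invertible. -/
noncomputable def ratio (k : Fin r) : Chart i :=
  algebraMap (Fixed r) (Chart i) (zz i k) * IsLocalization.Away.invSelf (zz i i)

/-- The coordinates on the chart as a homomorphism from a polynomial ring. -/
noncomputable def chartHom : MvPolynomial {j // j ≠ i} ℝ →ₐ[ℝ] Chart i :=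
  aeval fun j ↦ ratio i j

/-- The polynomial `1 + ∑ tⱼ²`. -/
noncomputable def chartDenom : MvPolynomial {j // j ≠ i} ℝ := 1 + ∑ j, X j ^ 2

theorem zz_mul_zz (i j k l : Fin r) : zz i j * zz k l = zz i k * zz j l := by
  ext
  change z i * z j * (z k * z l) = z i * z k * (z j * z l)
  ring

theorem ratio_self : ratio i i = 1 := IsLocalization.Away.mul_invSelf (zz i i)

theorem chartHom_X (j : {j // j ≠ i}) : chartHom i (X j) = ratio i j := aeval_X _ _

theorem ratio_mul_ratio (j k : Fin r) : ratio i j * ratio i k =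
    algebraMap (Fixed r) (Chart i) (zz j k) * IsLocalization.Away.invSelf (zz i i) := by
  have h := IsLocalization.Away.mul_invSelf (S := Chart i) (zz i i)
  have h2 : algebraMap (Fixed r) (Chart i) (zz i j) * algebraMap (Fixed r) (Chart i) (zz i k) =
      algebraMap (Fixed r) (Chart i) (zz i i) * algebraMap (Fixed r) (Chart i) (zz j k) := by
    rw [← map_mul, ← map_mul, zz_mul_zz]
  rw [ratio, ratio]
  linear_combination IsLocalization.Away.invSelf (zz i i) ^ 2 * h2 +
    algebraMap (Fixed r) (Chart i) (zz j k) * IsLocalization.Away.invSelf (zz i i) * h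

/-- With tₖ = zₖ / zᵢ and tᵢ = 1, the sum ∑ tₖ² equals (∑ zₖ²) / zᵢ² = 1 / zᵢ². -/
theorem chartHom_chartDenom :
    chartHom i (chartDenom i) = IsLocalization.Away.invSelf (zz i i) := by
  have h1 : chartHom i (chartDenom i) = ∑ k, ratio i k ^ 2 := by
    rw [chartDenom, map_add, map_one, map_sum]
    simp_rw [map_pow, chartHom_X]
    rw [← Finset.add_sum_erase Finset.univ _ (Finset.mem_univ i), ratio_self, one_pow,
      ← Finset.sum_subtype (p := fun j ↦ j ≠ i) (Finset.univ.erase i) (by simp)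
        (fun j ↦ ratio i j ^ 2)]
  rw [h1]
  simp_rw [sq, ratio_mul_ratio]
  rw [← Finset.sum_mul, ← map_sum, sum_zz_self, map_one, one_mul]

theorem algebraMap_zz_mul_chartHom_chartDenom :
    algebraMap (Fixed r) (Chart i) (zz i i) * chartHom i (chartDenom i) = 1 := by
  rw [chartHom_chartDenom, IsLocalization.Away.mul_invSelf]

theorem exists_mul_pow_mem_range (a : Chart i) :
    ∃ n p, a * chartHom i (chartDenom i) ^ n = chartHom i p := by
  have hfd := algebraMap_zz_mul_chartHom_chartDenom i
  have hratio : ∀ k, ∃ p, ratio i k = chartHom i p := fun k ↦ by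
    by_cases hk : k = i
    · exact ⟨1, by rw [hk, ratio_self, map_one]⟩
    · exact ⟨X ⟨k, hk⟩, (chartHom_X i ⟨k, hk⟩).symm⟩
  have key : ∀ b : Fixed r, ∃ n p,
      algebraMap (Fixed r) (Chart i) b * chartHom i (chartDenom i) ^ n = chartHom i p := by
    intro b
    have hb : b ∈ Algebra.adjoin ℝ (Set.range fun p : Fin r × Fin r ↦ zz p.1 p.2) := by
      rw [adjoin_range_zz]; trivial
    induction hb using Algebra.adjoin_induction with
    | mem x hx =>
      obtain ⟨⟨j, k⟩, rfl⟩ := hx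
      obtain ⟨p, hp⟩ := hratio j
      obtain ⟨q, hq⟩ := hratio k
      exact ⟨1, p * q, by
        rw [map_mul, ← hp, ← hq, ratio_mul_ratio, pow_one, chartHom_chartDenom]⟩
    | algebraMap c =>
      exact ⟨0, C c, by
        rw [pow_zero, mul_one, ← IsScalarTower.algebraMap_apply]
        exact ((chartHom i).commutes c).symm⟩
    | add x y _ _ hx hy =>
      obtain ⟨n, p, hp⟩ := hx
      obtain ⟨m, q, hq⟩ := hy
      refine ⟨n + m, p * chartDenom i ^ m + q * chartDenom i ^ n, ?_⟩
      simp only [map_add, map_mul, map_pow, ← hp, ← hq]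
      ring
    | mul x y _ _ hx hy =>
      obtain ⟨n, p, hp⟩ := hx
      obtain ⟨m, q, hq⟩ := hy
      refine ⟨n + m, p * q, ?_⟩
      simp only [map_mul, ← hp, ← hq]
      ring
  obtain ⟨n, b, hb⟩ := IsLocalization.Away.surj (zz i i) a
  obtain ⟨m, p, hp⟩ := key b
  refine ⟨m, p * chartDenom i ^ n, ?_⟩
  rw [map_mul, ← hp, ← hb, map_pow]
  have h : algebraMap (Fixed r) (Chart i) (zz i i) ^ n * chartHom i (chartDenom i) ^ n = 1 := by
    rw [← mul_pow, hfd, one_pow]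
  linear_combination (-a * chartHom i (chartDenom i) ^ m) * h

theorem chartHom_injective : Function.Injective (chartHom i) := by
  rw [injective_iff_map_eq_zero]
  intro p hp
  refine MvPolynomial.funext fun t ↦ ?_
  rw [map_zero]
  -- Every real `t` gives the chart coordinates of a point of the sphere: insert 1 in position `i`
  -- and normalize. So a polynomial killed by `chartHom` vanishes at `t`.
  let u : Fin r → ℝ := fun k ↦ if h : k = i then 1 else t ⟨k, h⟩
  have hu : u i = 1 := dif_pos rfl
  have hpos : 0 < ∑ k, u k ^ 2 :=
    Finset.sum_pos' (fun k _ ↦ sq_nonneg _) ⟨i, Finset.mem_univ i, by rw [hu]; norm_num⟩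
  set s := √(∑ k, u k ^ 2) with hs
  have hs0 : 0 < s := Real.sqrt_pos.2 hpos
  have hx : ∑ k, (u k / s) ^ 2 = 1 := by
    simp_rw [div_pow]
    rw [← Finset.sum_div, hs, Real.sq_sqrt hpos.le, div_self hpos.ne']
  let ev : Fixed r →ₐ[ℝ] ℝ := (evalAt _ hx).comp (Fixed r).val
  have hev : ∀ j k, ev (zz j k) = u j / s * (u k / s) := fun j k ↦ by
    change evalAt _ hx (z j * z k) = _
    rw [map_mul, evalAt_z, evalAt_z]
  have hne : ev (zz i i) ≠ 0 := by
    rw [hev, hu]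
    positivity
  let L : Chart i →+* ℝ := IsLocalization.Away.lift (zz i i) (g := ev.toRingHom) hne.isUnit
  have hL : ∀ a, L (algebraMap (Fixed r) (Chart i) a) = ev a := fun a ↦
    IsLocalization.Away.lift_eq _ _ a
  have hinv : ev (zz i i) * L (IsLocalization.Away.invSelf (zz i i)) = 1 := by
    rw [← hL, ← map_mul, IsLocalization.Away.mul_invSelf, map_one]
  have h : L.comp (chartHom i).toRingHom = eval t := by
    apply MvPolynomial.ringHom_ext
    · intro c
      rw [eval_C]
      change L (chartHom i (algebraMap ℝ _ c)) = c
      rw [AlgHom.commutes, IsScalarTower.algebraMap_apply ℝ (Fixed r) (Chart i), hL]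
      exact ev.commutes c
    · intro j
      rw [eval_X]
      change L (chartHom i (X j)) = t j
      rw [chartHom_X, ratio, map_mul, hL, hev, hu]
      rw [hev, hu] at hinv
      have hj : u j = t j := dif_neg j.2
      rw [hj]
      linear_combination t j * hinv
  rw [← h, RingHom.comp_apply]
  change L (chartHom i p) = 0
  rw [hp, map_zero]

/-- The chart is the polynomial ring in the tⱼ with 1 + ∑ tⱼ² inverted, hence étale over affine
space. -/
theorem smooth_chart : Algebra.Smooth ℝ (Chart i) := by
  let iA : Algebra (MvPolynomial {j // j ≠ i} ℝ) (Chart i) := (chartHom i).toRingHom.toAlgebra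
  let iS : SMul (MvPolynomial {j // j ≠ i} ℝ) (Chart i) := iA.toSMul
  have : IsScalarTower ℝ (MvPolynomial {j // j ≠ i} ℝ) (Chart i) :=
    .of_algebraMap_eq fun c ↦ ((chartHom i).commutes c).symm
  have : IsLocalization.Away (chartDenom i) (Chart i) := by
    refine ⟨?_, ?_, ?_⟩
    · rintro ⟨_, n, rfl⟩
      rw [map_pow]
      exact (IsUnit.of_mul_eq_one _ (mul_comm _ _ |>.trans
        (algebraMap_zz_mul_chartHom_chartDenom i))).pow n
    · intro a
      obtain ⟨n, p, h⟩ := exists_mul_pow_mem_range i a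
      exact ⟨(p, ⟨_, n, rfl⟩), by rw [map_pow]; exact h⟩
    · intro p q h
      exact ⟨1, by rw [chartHom_injective i h]⟩
  have : Algebra.Etale (MvPolynomial {j // j ≠ i} ℝ) (Chart i) :=
    .of_isLocalizationAway (chartDenom i)
  have : Algebra.Smooth ℝ (MvPolynomial {j // j ≠ i} ℝ) := ⟨inferInstance, inferInstance⟩
  exact .comp ℝ (MvPolynomial {j // j ≠ i} ℝ) (Chart i)

end Chart

theorem smooth_fixed (r : ℕ) : Algebra.Smooth ℝ (Fixed r) := by
  rw [← RingHom.smooth_algebraMap]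
  refine RingHom.Smooth.ofLocalizationSpanTarget _ (Set.range fun i : Fin r ↦ zz i i) ?_ ?_
  · rw [Ideal.eq_top_iff_one, ← sum_zz_self r]
    exact Ideal.sum_mem _ fun i _ ↦ Ideal.subset_span ⟨i, rfl⟩
  · rintro ⟨_, i, rfl⟩
    rw [← IsScalarTower.algebraMap_eq, RingHom.smooth_algebraMap]
    exact smooth_chart i

end SphereRing

/-! ### Parity of the dimension of a real algebra. -/

section OddDimension

/-- A finite-dimensional commutative real algebra without real points has even dimension. -/
theorem Real.even_finrank_of_isEmpty_algHom (n : ℕ) : ∀ (A : Type u) [CommRing A] [Algebra ℝ A]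
    [Module.Finite ℝ A], Module.finrank ℝ A = n → IsEmpty (A →ₐ[ℝ] ℝ) → Even n := by
  induction n using Nat.strong_induction_on with
  | _ n ih =>
    intro A _ _ _ hn hA
    rcases subsingleton_or_nontrivial A with h | h
    · rw [← hn, Module.finrank_zero_of_subsingleton]
      exact Even.zero
    have : IsArtinianRing A := IsArtinianRing.of_finite ℝ A
    -- A minimal ideal is isomorphic to a residue field, which must be ℂ since there are no real
    -- points. Dividing by it lowers the dimension by 2 and creates no real point.
    obtain ⟨N, hN, -⟩ := (IsAtomic.eq_bot_or_exists_atom_le (⊤ : Ideal A)).resolve_left top_ne_bot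
    have hs : IsSimpleModule A N := isSimpleModule_iff_isAtom.2 hN
    obtain ⟨m, hm, ⟨e⟩⟩ := isSimpleModule_iff_quot_maximal.1 hs
    have h2 : Module.finrank ℝ N = 2 := by
      let _ := Ideal.Quotient.field m
      rw [(e.restrictScalars ℝ).finrank_eq]
      rcases Real.nonempty_algEquiv_or (A ⧸ m) with ⟨⟨e'⟩⟩ | ⟨⟨e'⟩⟩
      · exact (hA.false (e'.toAlgHom.comp (Ideal.Quotient.mkₐ ℝ m))).elim
      · rw [e'.toLinearEquiv.finrank_eq, Complex.finrank_real_complex]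
    have hsum : Module.finrank ℝ (A ⧸ N) + Module.finrank ℝ N = n := by
      rw [← hn, ← Submodule.finrank_quotient_add_finrank (N.restrictScalars ℝ)]
      rfl
    have hq := ih (Module.finrank ℝ (A ⧸ N)) (by omega) (A ⧸ N) rfl
      ⟨fun φ ↦ hA.false (φ.comp (Ideal.Quotient.mkₐ ℝ N))⟩
    rw [← hsum, h2]
    exact hq.add even_two

end OddDimension

/-! ### Bases of the polynomial ring from deformed powers. -/

namespace MvPolynomial

theorem coeff_eq_zero_of_totalDegree_lt_degree {σ K : Type*} [CommRing K] {p : MvPolynomial σ K} {a : σ →₀ ℕ}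
    (h : p.totalDegree < a.degree) : coeff a p = 0 := by
  apply coeff_eq_zero_of_totalDegree_lt
  exact h

variable {σ K : Type*} [Fintype σ] [CommRing K]

noncomputable instance fintypeDegreeLE (k : ℕ) : Fintype {a : σ →₀ ℕ // a.degree ≤ k} :=
  (Finsupp.finite_of_degree_le k).fintype

/-- The matrix of coefficients of the polynomials `b a` with `a` of degree at most `k`. -/
def coeffMatrix (b : (σ →₀ ℕ) → MvPolynomial σ K) (k : ℕ) :
    Matrix {a : σ →₀ ℕ // a.degree ≤ k} {a : σ →₀ ℕ // a.degree ≤ k} K :=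
  .of fun a c ↦ coeff a.1 (b c.1)

/-- A linear relation among indices of degree at most `k` is a kernel vector of the `k`-th
coefficient matrix. -/
theorem linearIndependent_of_det_coeffMatrix_ne_zero [IsDomain K]
    {b : (σ →₀ ℕ) → MvPolynomial σ K} (h : ∀ k, (coeffMatrix b k).det ≠ 0) :
    LinearIndependent K b := by
  rw [linearIndependent_iff]
  intro l hl
  set k := l.support.sup Finsupp.degree
  have hk : ∀ a ∈ l.support, a.degree ≤ k := fun a ha ↦ Finset.le_sup (f := Finsupp.degree) ha
  have hv : (coeffMatrix b k).mulVec (fun a ↦ l a.1) = 0 := by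
    ext a
    have := congrArg (coeff a.1) hl
    rw [Finsupp.linearCombination_apply, Finsupp.sum, coeff_sum, coeff_zero] at this
    rw [Finset.sum_subset (s₂ := (Finsupp.finite_of_degree_le k).toFinset)
      (fun c hc ↦ by simpa using hk c hc)
      (fun c _ hc ↦ by rw [Finsupp.notMem_support_iff.1 hc, zero_smul, coeff_zero]),
      Finset.sum_subtype (p := fun c ↦ c.degree ≤ k) (F := fintypeDegreeLE k) _ (by simp)] at this
    rw [Pi.zero_apply, ← this, Matrix.mulVec, dotProduct]
    simp [coeffMatrix, mul_comm]
  have hv0 := Matrix.eq_zero_of_mulVec_eq_zero (h k) hv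
  ext a
  by_contra ha
  exact ha (congrFun hv0 ⟨a, hk a (Finsupp.mem_support_iff.2 ha)⟩)

theorem span_eq_top_of_det_coeffMatrix_ne_zero {K : Type*} [Field K]
    {b : (σ →₀ ℕ) → MvPolynomial σ K} (hb : ∀ a, (b a).totalDegree ≤ a.degree)
    (h : ∀ k, (coeffMatrix b k).det ≠ 0) : Submodule.span K (Set.range b) = ⊤ := by
  rw [eq_top_iff]
  rintro q -
  set k := q.totalDegree
  set v := (coeffMatrix b k)⁻¹.mulVec fun a ↦ coeff a.1 q
  have hv : (coeffMatrix b k).mulVec v = fun a ↦ coeff a.1 q := by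
    rw [Matrix.mulVec_mulVec, Matrix.mul_nonsing_inv _ (h k).isUnit, Matrix.one_mulVec]
  have hq : q = ∑ a, v a • b a.1 := by
    ext c
    rw [coeff_sum]
    by_cases hc : c.degree ≤ k
    · rw [← congrFun hv ⟨c, hc⟩]
      simp [Matrix.mulVec, dotProduct, coeffMatrix, mul_comm]
    -- The degree bound `hb` makes both sides vanish beyond degree `k`, so matching the truncated
    -- coefficients suffices.
    · rw [coeff_eq_zero_of_totalDegree_lt_degree (not_le.1 hc)]
      refine (Finset.sum_eq_zero fun a _ ↦ ?_).symm
      rw [coeff_smul, coeff_eq_zero_of_totalDegree_lt_degree, smul_zero]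
      exact ((hb a).trans a.2).trans_lt (not_le.1 hc)
  rw [hq]
  exact sum_mem fun a _ ↦ Submodule.smul_mem _ _ (Submodule.subset_span ⟨_, rfl⟩)

/-- The monomials in the variables and in the polynomials `gᵢ` whose exponents are the remainders
and the quotients of `a` by `d`. -/
noncomputable def divModMonomial (g : σ → MvPolynomial σ K) (d : ℕ) (a : σ →₀ ℕ) :
    MvPolynomial σ K :=
  ∏ i, (X i ^ (a i % d) * g i ^ (a i / d))

theorem totalDegree_divModMonomial_le [Nontrivial K] {g : σ → MvPolynomial σ K} {d : ℕ}
    (hg : ∀ i, (g i).totalDegree ≤ d) (a : σ →₀ ℕ) :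
    (divModMonomial g d a).totalDegree ≤ a.degree := by
  rw [divModMonomial, Finsupp.degree_eq_sum]
  refine (totalDegree_finsetProd _ _).trans (Finset.sum_le_sum fun i _ ↦ ?_)
  refine (totalDegree_mul _ _).trans ?_
  rw [totalDegree_X_pow]
  have h := (totalDegree_pow (g i) (a i / d)).trans (Nat.mul_le_mul_left _ (hg i))
  have h' := Nat.mod_add_div (a i) d
  rw [mul_comm] at h
  omega

theorem map_divModMonomial {L : Type*} [CommRing L] (φ : K →+* L) (g : σ → MvPolynomial σ K)
    (d : ℕ) (a : σ →₀ ℕ) :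
    map φ (divModMonomial g d a) = divModMonomial (fun i ↦ map φ (g i)) d a := by
  simp [divModMonomial]

theorem divModMonomial_X_pow (d : ℕ) (a : σ →₀ ℕ) :
    divModMonomial (fun i ↦ (X i ^ d : MvPolynomial σ K)) d a = monomial a 1 := by
  rw [monomial_eq, C_1, one_mul, divModMonomial, Finsupp.prod_fintype _ _ (by simp)]
  refine Finset.prod_congr rfl fun i _ ↦ ?_
  rw [← pow_mul, ← pow_add, Nat.mod_add_div]

/-- Multiplication by `g i` just shifts the index. Hence the ideal of the `g i` is spanned by the
members having some exponent at least `d`. -/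
theorem mul_divModMonomial (g : σ → MvPolynomial σ K) {d : ℕ} (hd : 0 < d) (i : σ)
    (a : σ →₀ ℕ) :
    g i * divModMonomial g d a = divModMonomial g d (a + Finsupp.single i d) := by
  classical
  rw [divModMonomial, divModMonomial, ← Finset.mul_prod_erase _ _ (Finset.mem_univ i),
    ← Finset.mul_prod_erase _ _ (Finset.mem_univ i), ← mul_assoc]
  congr 1
  · rw [Finsupp.add_apply, Finsupp.single_eq_same, Nat.add_mod_right, Nat.add_div_right _ hd]
    ring
  · refine Finset.prod_congr rfl fun j hj ↦ ?_
    rw [Finsupp.add_apply, Finsupp.single_eq_of_ne (Finset.ne_of_mem_erase hj), add_zero]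

theorem coeffMatrix_monomial (k : ℕ) :
    coeffMatrix (fun a : σ →₀ ℕ ↦ monomial a (1 : K)) k = 1 := by
  ext a c
  by_cases h : a = c
  · subst h
    rw [Matrix.one_apply_eq, coeffMatrix, Matrix.of_apply]
    classical rw [coeff_monomial, if_pos rfl]
  · rw [Matrix.one_apply_ne h, coeffMatrix, Matrix.of_apply]
    classical rw [coeff_monomial, if_neg fun h' ↦ h (Subtype.ext h'.symm)]

/-- The deformation `Xᵢ ^ d + s fᵢ` of the powers of the variables. -/
noncomputable def deform (d : ℕ) (f : σ → MvPolynomial σ K) (s : K) (i : σ) : MvPolynomial σ K :=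
  X i ^ d + C s * f i

/-- Taking `s` as an indeterminate, each determinant is a polynomial in `s` with value 1 at `s = 0`,
where the family consists of the monomials. Each has finitely many roots, and there is one
determinant for each `k`. -/
theorem exists_countable_det_ne_zero {K : Type*} [Field K] (d : ℕ) (f : σ → MvPolynomial σ K) :
    ∃ S : Set K, S.Countable ∧
      ∀ s ∉ S, ∀ k, (coeffMatrix (divModMonomial (deform d f s) d) k).det ≠ 0 := by
  let G : σ → MvPolynomial σ (Polynomial K) :=
    deform d (fun i ↦ map Polynomial.C (f i)) Polynomial.X
  let P : ℕ → Polynomial K := fun k ↦ (coeffMatrix (divModMonomial G d) k).det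
  have hP : ∀ k s, (P k).eval s = (coeffMatrix (divModMonomial (deform d f s) d) k).det := by
    intro k s
    rw [← Polynomial.coe_evalRingHom, RingHom.map_det]
    congr 1
    ext a c
    have hG : (fun i ↦ map (Polynomial.evalRingHom s) (G i)) = deform d f s := by
      funext i
      simp only [G, deform, map_add, map_pow, map_X, map_mul, map_C, map_map,
        Polynomial.coe_evalRingHom, Polynomial.eval_X]
      have : (Polynomial.evalRingHom s).comp Polynomial.C = RingHom.id K := by ext; simp
      rw [this, map_id]
    rw [← hG, RingHom.mapMatrix_apply, Matrix.map_apply]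
    simp only [coeffMatrix, Matrix.of_apply]
    rw [← coeff_map, map_divModMonomial]
  refine ⟨⋃ k, {s | (P k).IsRoot s}, Set.countable_iUnion fun k ↦ ?_, fun s hs k hk ↦ ?_⟩
  · refine (Polynomial.finite_setOfPred_isRoot fun h0 ↦ ?_).countable
    have h := hP k 0
    have h' : deform d f 0 = fun i ↦ X i ^ d := by
      funext i
      simp [deform]
    rw [h0, Polynomial.eval_zero, h', _root_.funext (divModMonomial_X_pow (K := K) d),
      coeffMatrix_monomial, Matrix.det_one] at h
    exact zero_ne_one h
  · exact hs (Set.mem_iUnion.2 ⟨k, (hP k s).trans hk⟩)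

end MvPolynomial

/-! ### Dimension of the quotient by the deformed system. -/

namespace MvPolynomial

variable {σ K : Type*} [Fintype σ] [Field K]

/-- A family of remainders modulo `d` as an exponent vector. -/
noncomputable def residueExponent {d : ℕ} (c : σ → Fin d) : σ →₀ ℕ :=
  Finsupp.equivFunOnFinite.symm fun i ↦ (c i : ℕ)

theorem residueExponent_apply {d : ℕ} (c : σ → Fin d) (i : σ) : residueExponent c i = c i := rfl

theorem residueExponent_injective {d : ℕ} :
    Function.Injective (residueExponent : (σ → Fin d) → σ →₀ ℕ) := fun _ _ h ↦
  _root_.funext fun i ↦ Fin.ext (DFunLike.congr_fun h i)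

/-- The coordinates of a polynomial at the reduced members of a basis. -/
noncomputable def residueCoord (B : Module.Basis (σ →₀ ℕ) K (MvPolynomial σ K)) (d : ℕ) :
    MvPolynomial σ K →ₗ[K] ((σ → Fin d) → K) :=
  LinearMap.pi fun c ↦ B.coord (residueExponent c)

theorem residueCoord_apply (B : Module.Basis (σ →₀ ℕ) K (MvPolynomial σ K)) (d : ℕ)
    (p : MvPolynomial σ K) (c : σ → Fin d) :
    residueCoord B d p c = B.repr p (residueExponent c) := rfl

theorem residueCoord_surjective (B : Module.Basis (σ →₀ ℕ) K (MvPolynomial σ K)) (d : ℕ) :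
    Function.Surjective (residueCoord B d) := by
  classical
  intro v
  refine ⟨∑ c, v c • B (residueExponent c), ?_⟩
  ext c
  rw [residueCoord_apply, map_sum, Finsupp.finsetSum_apply, Finset.sum_eq_single c]
  · simp
  · intro c' _ hc
    rw [map_smul, B.repr_self, Finsupp.smul_apply,
      Finsupp.single_eq_of_ne fun h ↦ hc (residueExponent_injective h).symm, smul_zero]
  · simp

variable {d : ℕ} (hd : 0 < d) (g : σ → MvPolynomial σ K)
  (B : Module.Basis (σ →₀ ℕ) K (MvPolynomial σ K)) (hB : ∀ a, B a = divModMonomial g d a)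

include hd hB

theorem ker_residueCoord :
    LinearMap.ker (residueCoord B d) = (Ideal.span (Set.range g)).restrictScalars K := by
  apply le_antisymm
  · intro p hp
    rw [LinearMap.mem_ker] at hp
    rw [← B.linearCombination_repr p]
    refine sum_mem fun a ha ↦ Submodule.smul_mem _ _ ?_
    obtain ⟨i, hi⟩ : ∃ i, d ≤ a i := by
      by_contra! h
      refine Finsupp.mem_support_iff.1 ha ?_
      have ha' : a = residueExponent fun i ↦ ⟨a i, h i⟩ := Finsupp.ext fun _ ↦ rfl
      rw [ha']
      exact congrFun hp _
    obtain ⟨a', rfl⟩ : ∃ a', a = a' + Finsupp.single i d :=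
      ⟨a - Finsupp.single i d, (tsub_add_cancel_of_le (Finsupp.single_le_iff.2 hi)).symm⟩
    rw [hB, ← mul_divModMonomial g hd]
    exact Ideal.mul_mem_right _ _ (Ideal.subset_span ⟨i, rfl⟩)
  · intro p hp
    rw [LinearMap.mem_ker]
    have hmul : ∀ i, residueCoord B d ∘ₗ LinearMap.mulLeft K (g i) = 0 := by
      intro i
      refine B.ext fun a ↦ ?_
      ext c
      rw [LinearMap.comp_apply, LinearMap.mulLeft_apply, hB, mul_divModMonomial g hd, ← hB,
        residueCoord_apply, B.repr_self, Finsupp.single_eq_of_ne]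
      · rfl
      · intro h
        have h' := DFunLike.congr_fun h i
        rw [residueExponent_apply, Finsupp.add_apply, Finsupp.single_eq_same] at h'
        have := (c i).2
        omega
    obtain ⟨q, rfl⟩ := Ideal.mem_span_range_iff_exists_fun.1 hp
    rw [map_sum]
    refine Finset.sum_eq_zero fun i _ ↦ ?_
    rw [mul_comm]
    exact LinearMap.congr_fun (hmul i) (q i)

/-- The residues modulo the ideal of the `gᵢ` as a space of functions. -/
noncomputable def quotientSpanEquiv :
    (MvPolynomial σ K ⧸ Ideal.span (Set.range g)) ≃ₗ[K] ((σ → Fin d) → K) :=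
  (Submodule.Quotient.restrictScalarsEquiv K (Ideal.span (Set.range g))).symm ≪≫ₗ
    Submodule.quotEquivOfEq _ _ (ker_residueCoord hd g B hB).symm ≪≫ₗ
    (residueCoord B d).quotKerEquivOfSurjective (residueCoord_surjective B d)

theorem finrank_quotient_span_range [DecidableEq σ] :
    Module.finrank K (MvPolynomial σ K ⧸ Ideal.span (Set.range g)) = d ^ Fintype.card σ := by
  rw [(quotientSpanEquiv hd g B hB).finrank_eq, Module.finrank_fintype_fun_eq_card,
    Fintype.card_fun, Fintype.card_fin]

end MvPolynomial

/-! ### Common real zeros of forms of odd degree. -/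

namespace MvPolynomial

theorem IsHomogeneous.aeval_mul {σ K A : Type*} [Fintype σ] [CommRing K] [CommRing A] [Algebra K A]
    {p : MvPolynomial σ K} {m : ℕ} (hp : p.IsHomogeneous m) (t : A) (x : σ → A) :
    MvPolynomial.aeval (fun i ↦ t * x i) p = t ^ m * MvPolynomial.aeval x p := by
  rw [aeval_def, aeval_def, eval₂_eq', eval₂_eq', Finset.mul_sum]
  refine Finset.sum_congr rfl fun a ha ↦ ?_
  have h : ∑ i, a i = m := by
    rw [← Finsupp.degree_eq_sum, Finsupp.degree_apply]
    exact (hp.degree_eq_sum_deg_support ha).symm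
  simp_rw [mul_pow, Finset.prod_mul_distrib]
  rw [Finset.prod_pow_eq_pow_sum, h]
  ring

theorem totalDegree_aeval_le {σ τ K : Type*} [Fintype σ] [CommRing K] (v : σ → MvPolynomial τ K)
    (hv : ∀ i, (v i).totalDegree ≤ 1) (p : MvPolynomial σ K) :
    (aeval v p).totalDegree ≤ p.totalDegree := by
  rw [aeval_def, eval₂_eq']
  refine totalDegree_finsetSum_le fun a ha ↦ (totalDegree_mul _ _).trans ?_
  rw [algebraMap_eq, totalDegree_C, zero_add]
  refine (totalDegree_finsetProd _ _).trans (le_trans ?_ (le_totalDegree ha))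
  rw [Finsupp.sum_fintype _ _ (fun _ ↦ rfl)]
  refine Finset.sum_le_sum fun i _ ↦ (totalDegree_pow _ _).trans ?_
  simpa using Nat.mul_le_mul_left (a i) (hv i)

/-- Polynomials of degree at most an odd number `d`, as many as variables, can be deformed by
`d`-th powers of the variables to have a common real zero. -/
theorem exists_countable_exists_eval_deform_eq_zero {n d : ℕ} (hd : Odd d)
    (f : Fin n → MvPolynomial (Fin n) ℝ) (hf : ∀ i, (f i).totalDegree ≤ d) :
    ∃ S : Set ℝ, S.Countable ∧
      ∀ s ∉ S, ∃ x : Fin n → ℝ, ∀ i, x i ^ d + s * eval x (f i) = 0 := by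
  obtain ⟨S, hS, hdet⟩ := exists_countable_det_ne_zero d f
  refine ⟨S, hS, fun s hs ↦ ?_⟩
  have hdeg : ∀ i, (deform d f s i).totalDegree ≤ d := fun i ↦ by
    refine (totalDegree_add _ _).trans (max_le ?_ ?_)
    · rw [totalDegree_X_pow]
    · refine (totalDegree_mul _ _).trans ?_
      rw [totalDegree_C, zero_add]
      exact hf i
  let B : Module.Basis (Fin n →₀ ℕ) ℝ (MvPolynomial (Fin n) ℝ) :=
    .mk (linearIndependent_of_det_coeffMatrix_ne_zero (hdet s hs))
      (span_eq_top_of_det_coeffMatrix_ne_zero (totalDegree_divModMonomial_le hdeg) (hdet s hs)).ge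
  have hB : ∀ a, B a = divModMonomial (deform d f s) d a := fun a ↦ Module.Basis.mk_apply _ _ a
  have := Module.Finite.equiv (quotientSpanEquiv hd.pos _ B hB).symm
  have hodd : Odd (Module.finrank ℝ
      (MvPolynomial (Fin n) ℝ ⧸ Ideal.span (Set.range (deform d f s)))) := by
    rw [finrank_quotient_span_range hd.pos _ B hB]
    exact hd.pow
  -- The quotient has odd dimension, so it has a real character, and the images of the variables
  -- form a common zero.
  by_contra! hno
  refine Nat.not_even_iff_odd.2 hodd (Real.even_finrank_of_isEmpty_algHom _ _ rfl ⟨fun φ ↦ ?_⟩)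
  let ψ := φ.comp (Ideal.Quotient.mkₐ ℝ (Ideal.span (Set.range (deform d f s))))
  obtain ⟨i, hi⟩ := hno fun i ↦ ψ (X i)
  refine hi ?_
  have h0 : ψ (deform d f s i) = 0 := by
    have h1 : Ideal.Quotient.mkₐ ℝ (Ideal.span (Set.range (deform d f s))) (deform d f s i) = 0 :=
      Ideal.Quotient.eq_zero_iff_mem.2 (Ideal.subset_span ⟨i, rfl⟩)
    change φ (Ideal.Quotient.mkₐ ℝ _ _) = 0
    rw [h1, map_zero]
  have h2 : ψ = aeval fun i ↦ ψ (X i) := by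
    apply algHom_ext
    intro j
    rw [aeval_X]
  rw [h2, deform, aeval_eq_eval] at h0
  simpa using h0

/-- **Borsuk–Ulam theorem** for homogeneous polynomials: `n` real forms of the same odd degree in
`n + 1` variables have a common zero on the unit sphere. -/
theorem exists_sum_sq_eq_one_and_eval_eq_zero {n d : ℕ} (hd : Odd d)
    (F : Fin n → MvPolynomial (Fin (n + 1)) ℝ) (hF : ∀ i, (F i).IsHomogeneous d) :
    ∃ u : Fin (n + 1) → ℝ, ∑ i, u i ^ 2 = 1 ∧ ∀ i, eval u (F i) = 0 := by
  let w : Fin (n + 1) → MvPolynomial (Fin n) ℝ := Fin.cons 1 X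
  have hw : ∀ i, (w i).totalDegree ≤ 1 := by
    intro i
    refine Fin.cases ?_ (fun j ↦ ?_) i
    · simp [w]
    · simp [w]
  obtain ⟨S, hS, hzero⟩ := exists_countable_exists_eval_deform_eq_zero hd
    (fun i ↦ aeval w (F i)) fun i ↦ (totalDegree_aeval_le w hw _).trans (hF i).totalDegree_le
  have heval : ∀ (x : Fin n → ℝ) i,
      eval x (aeval w (F i)) = eval (Fin.cons 1 x : Fin (n + 1) → ℝ) (F i) := by
    intro x i
    rw [← aeval_eq_eval, ← aeval_eq_eval]
    have h : (aeval x : MvPolynomial (Fin n) ℝ →ₐ[ℝ] ℝ).comp (aeval w) =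
        aeval (Fin.cons 1 x : Fin (n + 1) → ℝ) := by
      apply algHom_ext
      intro j
      refine Fin.cases ?_ (fun j ↦ ?_) j
      · simp [w]
      · simp [w]
    exact DFunLike.congr_fun h (F i)
  have hstep : ∀ k : ℕ, ∃ u : Fin (n + 1) → ℝ, ∑ i, u i ^ 2 = 1 ∧
      ∀ i, |eval u (F i)| ≤ 1 / ((k : ℝ) + 1) := by
    intro k
    -- An open interval is uncountable, so `s` can be taken above `k + 1` and outside `S`.
    obtain ⟨s, hs, hsS⟩ : ∃ s ∈ Set.Ioo ((k : ℝ) + 1) (k + 2), s ∉ S := by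
      by_contra! h
      linarith [Cardinal.Real.Ioo_countable_iff.1 (hS.mono h)]
    obtain ⟨x, hx⟩ := hzero s hsS
    have hs0 : 0 < s := lt_trans (by positivity) hs.1
    set v : Fin (n + 1) → ℝ := Fin.cons 1 x
    have hpos : 0 < ∑ i, v i ^ 2 :=
      Finset.sum_pos' (fun i _ ↦ sq_nonneg _) ⟨0, Finset.mem_univ _, by simp [v]⟩
    set N := √(∑ i, v i ^ 2) with hN
    have hN0 : 0 < N := Real.sqrt_pos.2 hpos
    have hu : ∑ i, (N⁻¹ * v i) ^ 2 = 1 := by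
      simp_rw [mul_pow]
      rw [← Finset.mul_sum, inv_pow, hN, Real.sq_sqrt hpos.le, inv_mul_cancel₀ hpos.ne']
    refine ⟨fun i ↦ N⁻¹ * v i, hu, fun i ↦ ?_⟩
    have hev : eval (fun i ↦ N⁻¹ * v i) (F i) = N⁻¹ ^ d * eval v (F i) := by
      rw [← aeval_eq_eval, ← aeval_eq_eval]
      exact (hF i).aeval_mul _ _
    -- By homogeneity the deformed equation survives normalization; on the sphere the numerator is
    -- at most 1 in absolute value, so the form is at most 1 / `s`.
    have h1 : eval (fun i ↦ N⁻¹ * v i) (F i) = -(N⁻¹ * v i.succ) ^ d / s := by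
      have h := hx i
      rw [heval] at h
      rw [hev, mul_pow, eq_div_iff hs0.ne']
      change x i ^ d + s * eval v (F i) = 0 at h
      change _ = -(N⁻¹ ^ d * x i ^ d)
      linear_combination N⁻¹ ^ d * h
    have h2 : |N⁻¹ * v i.succ| ≤ 1 := by
      rw [← sq_le_one_iff_abs_le_one, ← hu]
      exact Finset.single_le_sum (f := fun i ↦ (N⁻¹ * v i) ^ 2) (fun i _ ↦ sq_nonneg _)
        (Finset.mem_univ i.succ)
    rw [h1, abs_div, abs_neg, abs_pow, abs_of_pos hs0]
    exact div_le_div₀ zero_le_one (pow_le_one₀ (abs_nonneg _) h2) (by positivity) hs.1.le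
  choose u hu hFu using hstep
  have hcompact : IsCompact {u : Fin (n + 1) → ℝ | ∑ i, u i ^ 2 = 1} := by
    refine (isCompact_univ_pi fun _ ↦ isCompact_Icc (a := (-1 : ℝ)) (b := 1)).of_isClosed_subset
      (isClosed_eq (by fun_prop) continuous_const) fun u hu i _ ↦ ?_
    rw [Set.mem_Icc, ← abs_le, ← sq_le_one_iff_abs_le_one, ← (hu : ∑ i, u i ^ 2 = 1)]
    exact Finset.single_le_sum (f := fun i ↦ u i ^ 2) (fun i _ ↦ sq_nonneg _) (Finset.mem_univ i)
  obtain ⟨a, ha, φ, hφ, hlim⟩ := hcompact.tendsto_subseq hu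
  refine ⟨a, ha, fun i ↦ ?_⟩
  have h1 : Filter.Tendsto (fun k ↦ eval (u (φ k)) (F i)) Filter.atTop (nhds (eval a (F i))) :=
    ((continuous_eval (F i)).tendsto a).comp hlim
  have h2 : Filter.Tendsto (fun k ↦ eval (u (φ k)) (F i)) Filter.atTop (nhds 0) :=
    squeeze_zero_norm (fun k ↦ hFu (φ k) i)
      (tendsto_one_div_add_atTop_nhds_zero_nat.comp hφ.tendsto_atTop)
  exact tendsto_nhds_unique h1 h2

end MvPolynomial

/-! ### Odd regular functions and the lower bound. -/

namespace SphereRing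

variable {r : ℕ}

theorem isHomogeneous_sum_sq_pow (r l : ℕ) :
    ((∑ i : Fin r, X i ^ 2 : MvPolynomial (Fin r) ℝ) ^ l).IsHomogeneous (2 * l) :=
  .pow (.sum _ _ _ fun i _ ↦ by simpa using (isHomogeneous_X ℝ i).pow 2) l

theorem mk_mul_sum_sq_pow (p : MvPolynomial (Fin r) ℝ) (l : ℕ) :
    mk r (p * (∑ i, X i ^ 2) ^ l) = mk r p := by
  have h : mk r (∑ i, X i ^ 2) = 1 := by
    rw [map_sum, ← sum_z_sq r]
    exact Finset.sum_congr rfl fun i _ ↦ map_pow _ _ _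
  rw [map_mul, map_pow, h, one_pow, mul_one]

theorem neg_mk_of_isHomogeneous {p : MvPolynomial (Fin r) ℝ} {m : ℕ} (hp : p.IsHomogeneous m) :
    neg r (mk r p) = (-1) ^ m * mk r p := by
  have h1 : mk r = aeval z := by
    apply algHom_ext
    intro i
    rw [aeval_X]
    rfl
  have h2 : neg r (mk r p) = aeval (fun i ↦ -1 * z i : Fin r → SphereRing r) p := by
    simp_rw [neg_one_mul]
    rfl
  rw [h2, hp.aeval_mul, h1]

/-- Every element of `S` is the sum of the class of a form of degree `2 k` and the class of a form
of degree `2 k + 1`, for all large `k`. -/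
theorem exists_isHomogeneous_add (x : SphereRing r) : ∃ N, ∀ k ≥ N,
    ∃ F G : MvPolynomial (Fin r) ℝ, F.IsHomogeneous (2 * k) ∧ G.IsHomogeneous (2 * k + 1) ∧
      mk r F + mk r G = x := by
  obtain ⟨p, rfl⟩ := mk_surjective r x
  induction p using MvPolynomial.induction_on' with
  | monomial s c =>
    -- Powers of ∑ Xᵢ² have class 1, so they raise the degree by any even amount without changing
    -- the class.
    refine ⟨s.degree, fun k hk ↦ ?_⟩
    rcases Nat.even_or_odd' s.degree with ⟨l, hl | hl⟩
    · refine ⟨monomial s c * (∑ i, X i ^ 2) ^ (k - l), 0, ?_, isHomogeneous_zero _ _ _, ?_⟩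
      · convert (isHomogeneous_monomial c rfl).mul (isHomogeneous_sum_sq_pow r (k - l)) using 1
        omega
      · rw [mk_mul_sum_sq_pow, map_zero, add_zero]
    · refine ⟨0, monomial s c * (∑ i, X i ^ 2) ^ (k - l), isHomogeneous_zero _ _ _, ?_, ?_⟩
      · convert (isHomogeneous_monomial c rfl).mul (isHomogeneous_sum_sq_pow r (k - l)) using 1
        omega
      · rw [mk_mul_sum_sq_pow, map_zero, zero_add]
  | add p q hp hq =>
    obtain ⟨N, hN⟩ := hp
    obtain ⟨M, hM⟩ := hq
    refine ⟨max N M, fun k hk ↦ ?_⟩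
    obtain ⟨F, G, hF, hG, h⟩ := hN k (le_of_max_le_left hk)
    obtain ⟨F', G', hF', hG', h'⟩ := hM k (le_of_max_le_right hk)
    refine ⟨F + F', G + G', hF.add hF', hG.add hG', ?_⟩
    rw [map_add, map_add, map_add, ← h, ← h']
    ring

theorem exists_isHomogeneous_of_neg_eq_neg {x : SphereRing r} (hx : neg r x = -x) :
    ∃ N, ∀ k ≥ N, ∃ G : MvPolynomial (Fin r) ℝ, G.IsHomogeneous (2 * k + 1) ∧ mk r G = x := by
  obtain ⟨N, hN⟩ := exists_isHomogeneous_add x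
  refine ⟨N, fun k hk ↦ ?_⟩
  obtain ⟨F, G, hF, hG, h⟩ := hN k hk
  refine ⟨G, hG, ?_⟩
  have h1 : neg r x = mk r F - mk r G := by
    rw [← h, map_add, neg_mk_of_isHomogeneous hF, neg_mk_of_isHomogeneous hG, pow_succ, pow_mul]
    ring
  have h2 : (2 : ℝ) • mk r F = 0 := by
    rw [two_smul]
    rw [hx, ← h] at h1
    linear_combination -h1
  rw [← h, (smul_eq_zero_iff_right two_ne_zero).1 h2, zero_add]

/-- **Borsuk–Ulam theorem** for regular functions: fewer than `r` odd regular functions on the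
sphere in `r`-space have a common zero. -/
theorem exists_evalAt_eq_zero {m : ℕ} (hm : m < r) (c : Fin m → SphereRing r)
    (hc : ∀ i, neg r (c i) = -c i) :
    ∃ (u : Fin r → ℝ) (hu : ∑ i, u i ^ 2 = 1), ∀ i, evalAt u hu (c i) = 0 := by
  obtain ⟨n, rfl⟩ := Nat.exists_eq_add_of_le' (Nat.one_le_of_lt hm)
  choose N hN using fun i ↦ exists_isHomogeneous_of_neg_eq_neg (hc i)
  -- One `k` for all the functions gives forms of equal degree; zero forms then pad the family to
  -- one fewer than the number of variables.
  let k := Finset.univ.sup N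
  choose G hG hGc using fun i ↦ hN i k (Finset.le_sup (Finset.mem_univ i))
  let F : Fin n → MvPolynomial (Fin (n + 1)) ℝ := fun j ↦
    if h : (j : ℕ) < m then G ⟨j, h⟩ else 0
  have hF : ∀ j, (F j).IsHomogeneous (2 * k + 1) := by
    intro j
    by_cases h : (j : ℕ) < m
    · simpa only [F, dif_pos h] using hG _
    · simpa only [F, dif_neg h] using isHomogeneous_zero _ _ _
  obtain ⟨u, hu, hFu⟩ := exists_sum_sq_eq_one_and_eval_eq_zero (odd_two_mul_add_one k) F hF
  refine ⟨u, hu, fun i ↦ ?_⟩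
  have h := hFu ⟨i, by omega⟩
  simp only [F, dif_pos i.2] at h
  rw [← hGc, evalAt_mk, h]

/-- At a common zero `u` of the odd parts, the generators take equal values at `u` and `-u`; so do
the invariants, hence all of `S`. For the coordinates this forces `u = 0`, which is not on the
sphere. -/
theorem not_isGeneratedBy {m : ℕ} (hm : m < r) : ¬ IsGeneratedBy (Fixed r) (SphereRing r) m := by
  rintro ⟨a, ha⟩
  obtain ⟨u, hu, hzero⟩ := exists_evalAt_eq_zero hm (fun i ↦ a i - evenPart r (a i)) fun i ↦ by
    rw [map_sub, neg_coe]
    linear_combination add_neg (a i)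
  have key : ∀ x : SphereRing r, evalAt u hu (neg r x) = evalAt u hu x := by
    intro x
    have hx : x ∈ Algebra.adjoin (Fixed r) (Set.range a) := by
      rw [ha]; trivial
    induction hx using Algebra.adjoin_induction with
    | mem x hx =>
      obtain ⟨i, rfl⟩ := hx
      have h1 := hzero i
      rw [map_sub] at h1
      rw [eq_sub_of_add_eq' (add_neg (a i)), map_sub, map_mul, map_ofNat]
      linear_combination (-2) * h1
    | algebraMap c => exact congrArg _ (neg_coe c)
    | add x y _ _ hx hy => rw [map_add, map_add, hx, hy, map_add]
    | mul x y _ _ hx hy => rw [map_mul, map_mul, hx, hy, map_mul]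
  have hu0 : ∀ i, u i = 0 := fun i ↦ by
    have h := key (z i)
    rw [neg_z, map_neg, evalAt_z] at h
    linarith
  simp [hu0] at hu

end SphereRing

theorem mainTheorem2 :
    (∀ r : ℕ, 1 ≤ r →
      -- `R` is a smooth `ℝ`-algebra of dimension `r - 1`
      (Algebra.Smooth ℝ (SphereRing.Fixed r) ∧
        ringKrullDim (SphereRing.Fixed r) = ((r - 1 : ℕ) : WithBot ℕ∞)) ∧
      -- `S` is a quadratic étale `R`-algebra, generated by `r` elements but not by fewer
      (IsEtaleOfDegree (SphereRing.Fixed r) (SphereRing r) 2 ∧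
        IsGeneratedBy (SphereRing.Fixed r) (SphereRing r) r ∧
        ∀ m < r, ¬ IsGeneratedBy (SphereRing.Fixed r) (SphereRing r) m) ∧
      -- the same for the algebra `S × R^(n-2)` of degree `n`
      ∀ n : ℕ, 2 ≤ n →
        IsEtaleOfDegree (SphereRing.Fixed r)
          (SphereRing r × (Fin (n - 2) → SphereRing.Fixed r)) n ∧
        IsGeneratedBy (SphereRing.Fixed r)
          (SphereRing r × (Fin (n - 2) → SphereRing.Fixed r)) r ∧
        ∀ m < r, ¬ IsGeneratedBy (SphereRing.Fixed r)
          (SphereRing r × (Fin (n - 2) → SphereRing.Fixed r)) m) ∧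
    -- in every dimension `d` and degree `n ≥ 2` no bound smaller than `d + 1` is valid
    (∀ d n m : ℕ, 2 ≤ n →
      (∀ (R : Type) [CommRing R] [Algebra ℝ R], Algebra.Smooth ℝ R →
        ringKrullDim R = (d : WithBot ℕ∞) →
        ∀ (A : Type) [CommRing A] [Algebra R A], IsEtaleOfDegree R A n → IsGeneratedBy R A m) →
      d + 1 ≤ m) := by
  have main : ∀ r : ℕ, 1 ≤ r → ∀ n : ℕ, 2 ≤ n →
      IsEtaleOfDegree (SphereRing.Fixed r)
          (SphereRing r × (Fin (n - 2) → SphereRing.Fixed r)) n ∧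
        IsGeneratedBy (SphereRing.Fixed r)
          (SphereRing r × (Fin (n - 2) → SphereRing.Fixed r)) r ∧
        ∀ m < r, ¬ IsGeneratedBy (SphereRing.Fixed r)
          (SphereRing r × (Fin (n - 2) → SphereRing.Fixed r)) m := fun r hr n hn ↦
    ⟨SphereRing.isEtaleOfDegree_prod r n hn, SphereRing.isGeneratedBy_prod hr, fun m hm h ↦
      SphereRing.not_isGeneratedBy hm (h.of_surjective (AlgHom.fst _ _ _) Prod.fst_surjective)⟩
  refine ⟨fun r hr ↦ ⟨⟨SphereRing.smooth_fixed r, SphereRing.ringKrullDim_fixed hr⟩,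
    ⟨SphereRing.isEtaleOfDegree_two r, SphereRing.isGeneratedBy r, fun m hm ↦
      SphereRing.not_isGeneratedBy hm⟩, main r hr⟩, fun d n m hn h ↦ ?_⟩
  by_contra! hm
  -- The sphere in `d + 1` variables gives a fixed ring of dimension exactly `d`.
  obtain ⟨hE, -, hG⟩ := main (d + 1) (Nat.le_add_left 1 d) n hn
  exact hG m hm (h _ (SphereRing.smooth_fixed (d + 1))
    (SphereRing.ringKrullDim_fixed (Nat.le_add_left 1 d)) _ hE)
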